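/- A lattice-ordered group ($\ell$-group) is an algebra $\langle L,\wedge,\vee,\cdot,{}^{-1},e\rangle$ such that $\langle L,\cdot,{}^{-1},e\rangle$ is a group, $\langle L,\wedge,\vee\rangle$ is a lattice with order $a\le b\Leftrightarrow a\wedge b=a$, and $a\le b$ implies $cad\le cbd$ for all $a,b,c,d\in L$. An $\ell$-group equation is a pair $s\approx t$ of terms built from variables $x_0,x_1,x_2,\dots$ with the operation symbols $\wedge,\vee,\cdot,{}^{-1},e$; it is valid in all $\ell$-groups if $s$ and $t$ take the same value in every $\ell$-group under every assignment of elements to the variables. The problem of checking whether an equation is valid in all $\ell$-groups is decidable: there is an algorithm (a computable function on the Gödel numbers of pairs of terms) which, given any $\ell$-group equation $s\approx t$, decides whether it is valid in all $\ell$-groups. -/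

import Mathlib

universe u

/-- Terms in the signature `e, ⁻¹, ·, ∧, ∨` of lattice-ordered groups, over the countably many
variables `x₀, x₁, x₂, …`. -/
inductive LGroupTerm : Type
  | var (n : ℕ) : LGroupTerm
  | one : LGroupTerm
  | inv (t : LGroupTerm) : LGroupTerm
  | mul (s t : LGroupTerm) : LGroupTerm
  | inf (s t : LGroupTerm) : LGroupTerm
  | sup (s t : LGroupTerm) : LGroupTerm

namespace LGroupTerm

/-- The value of a term in an algebra with group and lattice operations, under the assignment
`v` of elements to the variables. -/
def eval {L : Type*} [Lattice L] [Group L] (v : ℕ → L) : LGroupTerm → L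
  | var n => v n
  | one => 1
  | inv t => (eval v t)⁻¹
  | mul s t => eval v s * eval v t
  | inf s t => eval v s ⊓ eval v t
  | sup s t => eval v s ⊔ eval v t

/-- The Gödel number of a term: `0` codes `e`, and a positive number `5 * m + r + 1` with `r < 5`
codes a variable or a compound term, where `r` tells the outermost symbol and `m` is the index of
the variable, the code of the argument, or the Cantor pair of the codes of the two arguments. -/
def toCode : LGroupTerm → ℕ
  | one => 0
  | var n => 5 * n + 1
  | inv t => 5 * toCode t + 1 + 1
  | mul s t => 5 * Nat.pair (toCode s) (toCode t) + 2 + 1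
  | inf s t => 5 * Nat.pair (toCode s) (toCode t) + 3 + 1
  | sup s t => 5 * Nat.pair (toCode s) (toCode t) + 4 + 1

/-- The term with a given Gödel number. -/
def ofCode : ℕ → LGroupTerm
  | 0 => one
  | n + 1 =>
    have _h0 : n / 5 < n + 1 := by omega
    have _h1 : (n / 5).unpair.1 < n + 1 := (Nat.unpair_left_le _).trans_lt _h0
    have _h2 : (n / 5).unpair.2 < n + 1 := (Nat.unpair_right_le _).trans_lt _h0
    match n % 5 with
    | 0 => var (n / 5)
    | 1 => inv (ofCode (n / 5))
    | 2 => mul (ofCode (n / 5).unpair.1) (ofCode (n / 5).unpair.2)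
    | 3 => inf (ofCode (n / 5).unpair.1) (ofCode (n / 5).unpair.2)
    | _ => sup (ofCode (n / 5).unpair.1) (ofCode (n / 5).unpair.2)

theorem ofCode_toCode (t : LGroupTerm) : ofCode (toCode t) = t := by
  induction t with
  | one => simp [toCode, ofCode]
  | var n =>
    have h1 : 5 * n / 5 = n := by omega
    have h2 : 5 * n % 5 = 0 := by omega
    rw [toCode, ofCode, h1, h2]
    rfl
  | inv t ih =>
    have h1 : (5 * toCode t + 1) / 5 = toCode t := by omega
    have h2 : (5 * toCode t + 1) % 5 = 1 := by omega
    rw [toCode, ofCode, h1, h2]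
    simp only [ih]
  | mul s t ihs iht =>
    have h1 : (5 * Nat.pair (toCode s) (toCode t) + 2) / 5 = Nat.pair (toCode s) (toCode t) := by
      omega
    have h2 : (5 * Nat.pair (toCode s) (toCode t) + 2) % 5 = 2 := by omega
    rw [toCode, ofCode, h1, h2]
    simp only [Nat.unpair_pair, ihs, iht]
  | inf s t ihs iht =>
    have h1 : (5 * Nat.pair (toCode s) (toCode t) + 3) / 5 = Nat.pair (toCode s) (toCode t) := by
      omega
    have h2 : (5 * Nat.pair (toCode s) (toCode t) + 3) % 5 = 3 := by omega
    rw [toCode, ofCode, h1, h2]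
    simp only [Nat.unpair_pair, ihs, iht]
  | sup s t ihs iht =>
    have h1 : (5 * Nat.pair (toCode s) (toCode t) + 4) / 5 = Nat.pair (toCode s) (toCode t) := by
      omega
    have h2 : (5 * Nat.pair (toCode s) (toCode t) + 4) % 5 = 4 := by omega
    rw [toCode, ofCode, h1, h2]
    simp only [Nat.unpair_pair, ihs, iht]

theorem toCode_ofCode (n : ℕ) : toCode (ofCode n) = n := by
  induction n using Nat.strong_induction_on with
  | _ n ih =>
    cases n with
    | zero => simp [toCode, ofCode]
    | succ n =>
      have h0 : n / 5 < n + 1 := by omega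
      have h1 := ih _ ((Nat.unpair_left_le _).trans_lt h0)
      have h2 := ih _ ((Nat.unpair_right_le _).trans_lt h0)
      have h3 := ih _ h0
      have hn := Nat.div_add_mod n 5
      have hlt := Nat.mod_lt n (show 5 > 0 by norm_num)
      rw [ofCode]
      generalize hr : n % 5 = r at hn hlt
      interval_cases r <;> simp only [toCode, h1, h2, h3, Nat.pair_unpair] <;> omega

/-- The Gödel numbering is a bijection between terms and natural numbers. -/
def codeEquiv : LGroupTerm ≃ ℕ where
  toFun := toCode
  invFun := ofCode
  left_inv := ofCode_toCode
  right_inv := toCode_ofCode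

/-- Computability of problems about terms refers to the Gödel numbering `toCode`. -/
instance : Denumerable LGroupTerm := Denumerable.mk' codeEquiv

end LGroupTerm

/-- The equation `s ≈ t` is valid in all lattice-ordered groups: it holds under every assignment
in every group carrying a lattice order for which left and right multiplications are monotone. -/
def ValidInLGroups (s t : LGroupTerm) : Prop :=
  ∀ (L : Type u) [Lattice L] [Group L] [MulLeftMono L] [MulRightMono L] (v : ℕ → L),
    s.eval v = t.eval v

/-!
Validity is a bounded search for a finite counterexample.

A lattice-ordered group `L` is a distributive lattice, so distinct elements are separated by a prime
lattice ideal `J`, or rather by their actions on the translates `x • J`. These translates form a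
chain, and `L` acts on it by order automorphisms, with meets and joins acting pointwise (Holland).
Hence an equation that fails in `L` fails at a point of a chain. Evaluating its two sides there
meets only finitely many points, whose number is bounded by the codes of the two sides; replaced by
their ranks, they give a finite diagram, with entries in `ℕ`, of partial automorphisms.

Conversely, the entries of any such diagram about the variables extend, by a back-and-forth
argument, to order automorphisms of `ℚ`. These form a lattice-ordered group, in which evaluating
terms reproduces the remaining entries, so the equation fails there.
-/

section LatticeOrderedGroup

variable {L : Type*} [Lattice L] [Group L] [MulLeftMono L] [MulRightMono L]

theorem inf_sup_le_inf_sup_inf (x y z : L) : x ⊓ (y ⊔ z) ≤ x ⊓ y ⊔ x ⊓ z := by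
  set m := y ⊔ z
  have le_inf_of_le_sup : ∀ w ≤ m, (x ⊓ m) * m⁻¹ * w ≤ x ⊓ w := fun w hw => by
    refine le_inf ?_ ?_
    · rw [mul_assoc]
      exact (mul_le_of_le_one_right' (inv_mul_le_one_iff.2 hw)).trans inf_le_left
    · exact mul_le_of_le_one_left' (mul_inv_le_one_iff_le.2 inf_le_right)
  calc x ⊓ m = (x ⊓ m) * m⁻¹ * (y ⊔ z) := (inv_mul_cancel_right _ _).symm
    _ = (x ⊓ m) * m⁻¹ * y ⊔ (x ⊓ m) * m⁻¹ * z := mul_sup _ _ _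
    _ ≤ x ⊓ y ⊔ x ⊓ z :=
      sup_le_sup (le_inf_of_le_sup y le_sup_left) (le_inf_of_le_sup z le_sup_right)

/-- The underlying lattice of a lattice-ordered group is distributive. -/
abbrev latticeOrderedGroupDistribLattice : DistribLattice L :=
  DistribLattice.ofInfSupLe inf_sup_le_inf_sup_inf

theorem mul_inf_mul_le_mul_sup_mul (x y a b : L) : y * a ⊓ x * b ≤ x * a ⊔ y * b := by
  rw [← inv_mul_le_one_iff]
  have le_inv_mul : (x * a ⊔ y * b)⁻¹ * (y * a ⊓ x * b) ≤ a⁻¹ * b :=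
    calc _ ≤ (x * a)⁻¹ * (x * b) := mul_le_mul' (inv_le_inv_iff.2 le_sup_left) inf_le_right
      _ = a⁻¹ * b := by rw [mul_inv_rev, mul_assoc, inv_mul_cancel_left]
  have le_inv_mul_inv : (x * a ⊔ y * b)⁻¹ * (y * a ⊓ x * b) ≤ (a⁻¹ * b)⁻¹ :=
    calc _ ≤ (y * b)⁻¹ * (y * a) := mul_le_mul' (inv_le_inv_iff.2 le_sup_right) inf_le_left
      _ = (a⁻¹ * b)⁻¹ := by rw [mul_inv_rev, mul_inv_rev, inv_inv, mul_assoc, inv_mul_cancel_left]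
  calc _ ≤ (a⁻¹ * b)⁻¹ ⊓ (a⁻¹ * b) := le_inf le_inv_mul_inv le_inv_mul
    _ = (|a⁻¹ * b|ₘ)⁻¹ := by rw [mabs, inv_sup, inv_inv]
    _ ≤ 1 := inv_le_one'.2 (one_le_mabs _)

end LatticeOrderedGroup

/-- An action of a lattice-ordered group on a chain by order automorphisms under which meets and
joins act pointwise, that is, a homomorphism of lattice-ordered groups to the automorphisms of the
chain. -/
class IsChainAction (L Ω : Type*) [Lattice L] [Group L] [LinearOrder Ω] [MulAction L Ω] :
    Prop where
  strictMono_smul (a : L) : StrictMono (a • · : Ω → Ω)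
  sup_smul (a b : L) (x : Ω) : (a ⊔ b) • x = max (a • x) (b • x)
  inf_smul (a b : L) (x : Ω) : (a ⊓ b) • x = min (a • x) (b • x)

section Holland

open Order Pointwise

variable {L : Type*} [Lattice L] [Group L] [MulLeftMono L] [MulRightMono L] {J : Ideal L}

theorem sup_smul_of_mem_orbit (hJ : J.IsPrime) {A : Set L} (hA : A ∈ MulAction.orbit L (J : Set L))
    (x y : L) : (x ⊔ y) • A = x • A ∪ y • A := by
  obtain ⟨z, rfl⟩ := hA
  ext a
  simp only [Set.mem_union, Set.mem_smul_set_iff_inv_smul_mem, smul_eq_mul, SetLike.mem_coe,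
    inv_sup, inf_mul, mul_inf]
  exact ⟨hJ.mem_or_mem, Or.rec (J.lower inf_le_left) (J.lower inf_le_right)⟩

theorem inf_smul_of_mem_orbit {A : Set L} (hA : A ∈ MulAction.orbit L (J : Set L)) (x y : L) :
    (x ⊓ y) • A = x • A ∩ y • A := by
  obtain ⟨z, rfl⟩ := hA
  ext a
  simp only [Set.mem_inter_iff, Set.mem_smul_set_iff_inv_smul_mem, smul_eq_mul, SetLike.mem_coe,
    inv_inf, sup_mul, mul_sup, Ideal.sup_mem_iff]

theorem isChain_orbit_ideal (hJ : J.IsPrime) :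
    IsChain (· ≤ ·) (MulAction.orbit L (J : Set L)) := by
  rintro - ⟨x, rfl⟩ - ⟨y, rfl⟩ -
  by_contra! h
  simp only [Set.not_subset, Set.mem_smul_set_iff_inv_smul_mem, smul_eq_mul,
    SetLike.mem_coe] at h
  obtain ⟨⟨a, hxa, hya⟩, b, hyb, hxb⟩ := h
  have inf_mem : y⁻¹ * a ⊓ x⁻¹ * b ∈ J :=
    J.lower (mul_inf_mul_le_mul_sup_mul x⁻¹ y⁻¹ a b) (J.sup_mem hxa hyb)
  exact (hJ.mem_or_mem inf_mem).elim hya hxb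

open Classical in
/-- The chain of translates of a prime ideal of a lattice-ordered group, ordered by inclusion. -/
noncomputable abbrev orbitIdealLinearOrder (hJ : J.IsPrime) :
    LinearOrder (MulAction.orbit L (J : Set L)) :=
  (isChain_orbit_ideal hJ).linearOrder

theorem isChainAction_orbit_ideal (hJ : J.IsPrime) :
    letI := orbitIdealLinearOrder hJ
    IsChainAction L (MulAction.orbit L (J : Set L)) :=
  letI := orbitIdealLinearOrder hJ
  have coe_mono : Monotone ((↑) : MulAction.orbit L (J : Set L) → Set L) := fun _ _ h => h
  { strictMono_smul a := Monotone.strictMono_of_injective (fun _ _ h => Set.smul_set_mono h)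
      (MulAction.injective a)
    sup_smul a b A := Subtype.ext <|
      (sup_smul_of_mem_orbit hJ A.2 a b).trans (coe_mono.map_sup (a • A) (b • A)).symm
    inf_smul a b A := Subtype.ext <|
      (inf_smul_of_mem_orbit A.2 a b).trans (coe_mono.map_inf (a • A) (b • A)).symm }

theorem exists_isPrime_mem_notMem {α : Type*} [DistribLattice α] {a b : α} (h : ¬ b ≤ a) :
    ∃ J : Ideal α, J.IsPrime ∧ a ∈ J ∧ b ∉ J := by
  obtain ⟨J, hJ, ha, hb⟩ := DistribLattice.prime_ideal_of_disjoint_filter_ideal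
    (F := PFilter.principal b) (I := Ideal.principal a)
    (Set.disjoint_left.2 fun c hbc hca => h (le_trans hbc hca))
  exact ⟨J, hJ, ha le_rfl, Set.disjoint_left.1 hb le_rfl⟩

theorem exists_isChainAction_smul_ne {L : Type u} [Lattice L] [Group L] [MulLeftMono L]
    [MulRightMono L] {g h : L} (hgh : g ≠ h) :
    ∃ (Ω : Type u) (_ : LinearOrder Ω) (_ : MulAction L Ω) (_ : IsChainAction L Ω) (x : Ω),
      g • x ≠ h • x := by
  wlog hle : ¬ g ≤ h generalizing g h
  · obtain ⟨Ω, i₁, i₂, i₃, x, hx⟩ := this hgh.symm fun hge => hgh ((not_not.1 hle).antisymm hge)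
    exact ⟨Ω, i₁, i₂, i₃, x, hx.symm⟩
  let _ : DistribLattice L := latticeOrderedGroupDistribLattice
  obtain ⟨J, hJ, hg, hh⟩ := exists_isPrime_mem_notMem (a := g⁻¹) (b := h⁻¹) (by simpa using hle)
  refine ⟨_, orbitIdealLinearOrder hJ, inferInstance, isChainAction_orbit_ideal hJ,
    ⟨J, MulAction.mem_orbit_self _⟩, fun hx => hh ?_⟩
  have one_mem : (1 : L) ∈ g • (J : Set L) := Set.mem_smul_set_iff_inv_smul_mem.2 (by simpa)
  rw [show g • (J : Set L) = h • (J : Set L) from congrArg Subtype.val hx,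
    Set.mem_smul_set_iff_inv_smul_mem] at one_mem
  simpa using one_mem

end Holland

section Diagram

variable {α β : Type*} [LinearOrder α] [LinearOrder β]

/-- An entry `(t, i, j)` of a set `D` says that the value of `t` sends the point `i` to the point
`j`. The entry is justified in `D` if `t` is a variable, or if it follows from entries of `D` about
the arguments of `t`. -/
inductive IsJustified (D : Set (LGroupTerm × α × α)) : LGroupTerm → α → α → Prop
  | var (n : ℕ) (i j : α) : IsJustified D (.var n) i j
  | one (i : α) : IsJustified D .one i i
  | inv {t : LGroupTerm} {i j : α} : (t, j, i) ∈ D → IsJustified D (.inv t) i j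
  | mul {s t : LGroupTerm} {i j k : α} :
      (t, i, j) ∈ D → (s, j, k) ∈ D → IsJustified D (.mul s t) i k
  | inf {s t : LGroupTerm} {i j k : α} :
      (s, i, j) ∈ D → (t, i, k) ∈ D → IsJustified D (.inf s t) i (min j k)
  | sup {s t : LGroupTerm} {i j k : α} :
      (s, i, j) ∈ D → (t, i, k) ∈ D → IsJustified D (.sup s t) i (max j k)

theorem IsJustified.map {D : Set (LGroupTerm × α × α)} {E : Set (LGroupTerm × β × β)} {f : α → β}
    (hf : Monotone f) (hDE : ∀ {t i j}, (t, i, j) ∈ D → (t, f i, f j) ∈ E) {t : LGroupTerm}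
    {i j : α} (h : IsJustified D t i j) : IsJustified E t (f i) (f j) := by
  cases h with
  | var => exact .var ..
  | one => exact .one _
  | inv ht => exact .inv (hDE ht)
  | mul ht hs => exact .mul (hDE ht) (hDE hs)
  | inf hs ht => exact hf.map_min ▸ .inf (hDE hs) (hDE ht)
  | sup hs ht => exact hf.map_max ▸ .sup (hDE hs) (hDE ht)

theorem IsJustified.mono {D E : Set (LGroupTerm × α × α)} (hDE : D ⊆ E) {t : LGroupTerm}
    {i j : α} (h : IsJustified D t i j) : IsJustified E t i j :=
  h.map monotone_id fun he => hDE he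

/-- A diagram is a partial description of automorphisms of a chain: the entries with a common term
form a partial order isomorphism, and every entry about a compound term is justified. -/
structure IsDiagram (D : Set (LGroupTerm × α × α)) : Prop where
  lt_iff_lt {t : LGroupTerm} {i j i' j' : α} :
    (t, i, j) ∈ D → (t, i', j') ∈ D → (i < i' ↔ j < j')
  isJustified {t : LGroupTerm} {i j : α} : (t, i, j) ∈ D → IsJustified D t i j

/-- A diagram refutes `s ≈ t` if in it `s` and `t` send some point to different points. -/
structure Refutes (D : Set (LGroupTerm × α × α)) (s t : LGroupTerm) : Prop where
  isDiagram : IsDiagram D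
  exists_ne : ∃ i j k, (s, i, j) ∈ D ∧ (t, i, k) ∈ D ∧ j ≠ k

theorem Refutes.image {D : Set (LGroupTerm × α × α)} {s t : LGroupTerm} (h : Refutes D s t)
    {f : α → β} (hf : Monotone f) {S : Set α} (hfS : StrictMonoOn f S)
    (hDS : ∀ {r i j}, (r, i, j) ∈ D → i ∈ S ∧ j ∈ S) :
    Refutes (Prod.map id (Prod.map f f) '' D) s t where
  isDiagram :=
    { lt_iff_lt := by
        rintro r - - - - ⟨⟨_, i, j⟩, hij, ⟨⟩⟩ ⟨⟨_, i', j'⟩, hij', ⟨⟩⟩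
        exact (hfS.lt_iff_lt (hDS hij).1 (hDS hij').1).trans <|
          (h.isDiagram.lt_iff_lt hij hij').trans (hfS.lt_iff_lt (hDS hij).2 (hDS hij').2).symm
      isJustified := by
        rintro r - - ⟨⟨_, i, j⟩, hij, ⟨⟩⟩
        exact (h.isDiagram.isJustified hij).map hf fun he => Set.mem_image_of_mem _ he }
  exists_ne := by
    obtain ⟨i, j, k, hs, ht, hjk⟩ := h.exists_ne
    exact ⟨f i, f j, f k, Set.mem_image_of_mem _ hs, Set.mem_image_of_mem _ ht,
      hfS.injOn.ne (hDS hs).2 (hDS ht).2 hjk⟩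

theorem IsDiagram.eval_smul_eq {L : Type*} [Lattice L] [Group L] [MulAction L α]
    [IsChainAction L α] {D : Set (LGroupTerm × α × α)} (hD : IsDiagram D) {v : ℕ → L}
    (hv : ∀ {n i j}, (.var n, i, j) ∈ D → v n • i = j) {t : LGroupTerm} {i j : α}
    (h : (t, i, j) ∈ D) : t.eval v • i = j := by
  induction t generalizing i j with
  | var n => exact hv h
  | one => cases hD.isJustified h with | one => exact one_smul L i
  | inv t iht =>
    cases hD.isJustified h with | inv ht => exact inv_smul_eq_iff.2 (iht ht).symm
  | mul s t ihs iht =>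
    cases hD.isJustified h with
    | mul ht hs => rw [LGroupTerm.eval, mul_smul, iht ht, ihs hs]
  | inf s t ihs iht =>
    cases hD.isJustified h with
    | inf hs ht => rw [LGroupTerm.eval, IsChainAction.inf_smul, ihs hs, iht ht]
  | sup s t ihs iht =>
    cases hD.isJustified h with
    | sup hs ht => rw [LGroupTerm.eval, IsChainAction.sup_smul, ihs hs, iht ht]

end Diagram

section Trace

variable {L Ω : Type*} [Lattice L] [Group L] [MulAction L Ω]

/-- The entries met when evaluating a term at a point, one for each occurrence of a subterm. -/
def trace (v : ℕ → L) : LGroupTerm → Ω → List (LGroupTerm × Ω × Ω)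
  | .var n, x => [(.var n, x, v n • x)]
  | .one, x => [(.one, x, x)]
  | .inv t, x => (.inv t, x, (t.eval v)⁻¹ • x) :: trace v t ((t.eval v)⁻¹ • x)
  | .mul s t, x =>
    (.mul s t, x, (s.eval v * t.eval v) • x) :: (trace v t x ++ trace v s (t.eval v • x))
  | .inf s t, x => (.inf s t, x, (s.eval v ⊓ t.eval v) • x) :: (trace v s x ++ trace v t x)
  | .sup s t, x => (.sup s t, x, (s.eval v ⊔ t.eval v) • x) :: (trace v s x ++ trace v t x)

theorem mem_trace_self (v : ℕ → L) (t : LGroupTerm) (x : Ω) :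
    (t, x, t.eval v • x) ∈ trace v t x := by
  cases t <;> simp [trace, LGroupTerm.eval]

theorem eval_smul_eq_of_mem_trace {v : ℕ → L} {t r : LGroupTerm} {x y z : Ω}
    (h : (r, y, z) ∈ trace v t x) : r.eval v • y = z := by
  induction t generalizing x <;>
    simp only [trace, List.mem_cons, List.mem_append, List.not_mem_nil, or_false,
      Prod.mk.injEq] at h <;>
    grind [LGroupTerm.eval, one_smul]

theorem toCode_le_of_mem_trace {v : ℕ → L} {t r : LGroupTerm} {x y z : Ω}
    (h : (r, y, z) ∈ trace v t x) : r.toCode ≤ t.toCode := by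
  induction t generalizing x <;>
    simp only [trace, List.mem_cons, List.mem_append, List.not_mem_nil, or_false,
      Prod.mk.injEq] at h <;>
    grind [LGroupTerm.toCode, Nat.left_le_pair, Nat.right_le_pair]

theorem length_trace_le (v : ℕ → L) (t : LGroupTerm) (x : Ω) :
    (trace v t x).length ≤ t.toCode + 1 := by
  induction t generalizing x <;>
    grind [trace, LGroupTerm.toCode, Nat.add_le_pair]

theorem trace_subset_trace {v : ℕ → L} {t r : LGroupTerm} {x y z : Ω}
    (h : (r, y, z) ∈ trace v t x) : trace v r y ⊆ trace v t x := by
  induction t generalizing x <;>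
    simp only [trace, List.mem_cons, List.mem_append, List.not_mem_nil, or_false,
      Prod.mk.injEq] at h <;>
    grind [trace]

theorem isJustified_trace_self [LinearOrder Ω] [IsChainAction L Ω] (v : ℕ → L) (t : LGroupTerm)
    (x : Ω) : IsJustified {e | e ∈ trace v t x} t x (t.eval v • x) := by
  cases t with
  | var n => exact .var ..
  | one => exact (one_smul L x).symm ▸ .one x
  | inv t =>
    refine .inv (List.mem_cons_of_mem _ ?_)
    simpa [LGroupTerm.eval] using mem_trace_self v t ((t.eval v)⁻¹ • x)
  | mul s t =>
    rw [LGroupTerm.eval, mul_smul]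
    exact .mul (List.mem_cons_of_mem _ (List.mem_append_left _ (mem_trace_self v t x)))
      (List.mem_cons_of_mem _ (List.mem_append_right _ (mem_trace_self v s _)))
  | inf s t =>
    rw [LGroupTerm.eval, IsChainAction.inf_smul]
    exact .inf (List.mem_cons_of_mem _ (List.mem_append_left _ (mem_trace_self v s x)))
      (List.mem_cons_of_mem _ (List.mem_append_right _ (mem_trace_self v t x)))
  | sup s t =>
    rw [LGroupTerm.eval, IsChainAction.sup_smul]
    exact .sup (List.mem_cons_of_mem _ (List.mem_append_left _ (mem_trace_self v s x)))
      (List.mem_cons_of_mem _ (List.mem_append_right _ (mem_trace_self v t x)))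

theorem isJustified_of_mem_trace [LinearOrder Ω] [IsChainAction L Ω] {v : ℕ → L}
    {t r : LGroupTerm} {x y z : Ω} (h : (r, y, z) ∈ trace v t x) :
    IsJustified {e | e ∈ trace v t x} r y z :=
  eval_smul_eq_of_mem_trace h ▸ (isJustified_trace_self v r y).mono fun _ he =>
    trace_subset_trace h he

theorem refutes_trace_append_trace [LinearOrder Ω] [IsChainAction L Ω] {v : ℕ → L}
    {s t : LGroupTerm} {x : Ω} (h : s.eval v • x ≠ t.eval v • x) :
    Refutes {e | e ∈ trace v s x ++ trace v t x} s t where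
  isDiagram :=
    { lt_iff_lt := fun {r i j i' j'} hij hij' => by
        have eval_smul_eq {y z : Ω} (he : (r, y, z) ∈ trace v s x ++ trace v t x) :
            r.eval v • y = z :=
          (List.mem_append.1 he).elim eval_smul_eq_of_mem_trace eval_smul_eq_of_mem_trace
        rw [← eval_smul_eq hij, ← eval_smul_eq hij']
        exact (IsChainAction.strictMono_smul (r.eval v)).lt_iff_lt.symm
      isJustified := fun he => (List.mem_append.1 he).elim
        (fun he => (isJustified_of_mem_trace he).mono fun _ => List.mem_append_left _)
        (fun he => (isJustified_of_mem_trace he).mono fun _ => List.mem_append_right _) }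
  exists_ne := ⟨x, _, _, List.mem_append_left _ (mem_trace_self v s x),
    List.mem_append_right _ (mem_trace_self v t x), h⟩

end Trace

theorem exists_monotone_strictMonoOn_lt_card {α : Type*} [LinearOrder α] (S : Finset α) :
    ∃ f : α → ℕ, Monotone f ∧ StrictMonoOn f S ∧ ∀ x ∈ S, f x < S.card := by
  have filter_mono {x y : α} (hxy : x ≤ y) : S.filter (· < x) ⊆ S.filter (· < y) :=
    Finset.monotone_filter_right S fun z _ (hz : z < x) => hz.trans_le hxy
  refine ⟨fun x => (S.filter (· < x)).card, fun x y hxy => Finset.card_le_card (filter_mono hxy),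
    fun x hx y _ hxy => Finset.card_lt_card ?_, fun x hx => Finset.card_lt_card ?_⟩
  · exact (Finset.ssubset_iff_of_subset (filter_mono hxy.le)).2
      ⟨x, Finset.mem_filter.2 ⟨hx, hxy⟩, by simp⟩
  · exact Finset.filter_ssubset.2 ⟨x, hx, lt_irrefl x⟩

section Automorphisms

variable {α : Type*} [LinearOrder α]

instance : PartialOrder (α ≃o α) := PartialOrder.lift (⇑) DFunLike.coe_injective

/-- The pointwise maximum of two automorphisms of a chain. -/
def autSup (f g : α ≃o α) : α ≃o α :=
  StrictMono.orderIsoOfRightInverse (fun x => max (f x) (g x))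
    (fun _ _ h => max_lt_max (f.strictMono h) (g.strictMono h))
    (fun y => min (f.symm y) (g.symm y)) fun y => by
      rcases le_total (f.symm y) (g.symm y) with h | h
      · simpa [h] using g.monotone h
      · simpa [h] using f.monotone h

/-- The pointwise minimum of two automorphisms of a chain. -/
def autInf (f g : α ≃o α) : α ≃o α :=
  StrictMono.orderIsoOfRightInverse (fun x => min (f x) (g x))
    (fun _ _ h => min_lt_min (f.strictMono h) (g.strictMono h))
    (fun y => max (f.symm y) (g.symm y)) fun y => by
      rcases le_total (f.symm y) (g.symm y) with h | h
      · simpa [h] using f.monotone h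
      · simpa [h] using g.monotone h

instance : Lattice (α ≃o α) where
  sup := autSup
  inf := autInf
  le_sup_left f g x := le_max_left (f x) (g x)
  le_sup_right f g x := le_max_right (f x) (g x)
  sup_le _ _ _ hf hg x := max_le (hf x) (hg x)
  inf_le_left f g x := min_le_left (f x) (g x)
  inf_le_right f g x := min_le_right (f x) (g x)
  le_inf _ _ _ hf hg x := le_min (hf x) (hg x)

instance : MulLeftMono (α ≃o α) := ⟨fun f _ _ h x => f.monotone (h x)⟩

instance : MulRightMono (α ≃o α) := ⟨fun f _ _ h x => h (f x)⟩

instance : IsChainAction (α ≃o α) α where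
  strictMono_smul f := f.strictMono
  sup_smul _ _ _ := rfl
  inf_smul _ _ _ := rfl

end Automorphisms

section BackAndForth

open Order PartialIso

theorem exists_orderIso_extending {α β : Type*} [LinearOrder α] [LinearOrder β]
    [Countable α] [DenselyOrdered α] [NoMinOrder α] [NoMaxOrder α] [Nonempty α]
    [Countable β] [DenselyOrdered β] [NoMinOrder β] [NoMaxOrder β] [Nonempty β]
    (p : PartialIso α β) : ∃ F : α ≃o β, ∀ q ∈ p.val, F q.1 = q.2 := by
  cases nonempty_encodable α
  cases nonempty_encodable β
  let 𝒟 : α ⊕ β → Cofinal (PartialIso α β) := Sum.elim (definedAtLeft β) (definedAtRight α)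
  let I : Ideal (PartialIso α β) := idealOfCofinals p 𝒟
  have cmp_eq_cmp {q r : α × β} : (∃ f ∈ I, q ∈ f.val) → (∃ f ∈ I, r ∈ f.val) →
      cmp q.1 r.1 = cmp q.2 r.2 := by
    rintro ⟨f, hf, hq⟩ ⟨g, hg, hr⟩
    obtain ⟨m, _, hfm, hgm⟩ := I.directed f hf g hg
    exact m.prop q (hfm hq) r (hgm hr)
  have exists_image (a : α) : ∃ b, ∃ f ∈ I, (a, b) ∈ f.val := by
    obtain ⟨f, ⟨b, hb⟩, hf⟩ := cofinal_meets_idealOfCofinals p 𝒟 (.inl a)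
    exact ⟨b, f, hf, hb⟩
  have exists_preimage (b : β) : ∃ a, ∃ f ∈ I, (a, b) ∈ f.val := by
    obtain ⟨f, ⟨a, ha⟩, hf⟩ := cofinal_meets_idealOfCofinals p 𝒟 (.inr b)
    exact ⟨a, f, hf, ha⟩
  choose F hF using exists_image
  choose G hG using exists_preimage
  refine ⟨OrderIso.ofCmpEqCmp F G fun a b => cmp_eq_cmp (hF a) (hG b), fun q hq => ?_⟩
  exact (eq_iff_eq_of_cmp_eq_cmp
    (cmp_eq_cmp (hF q.1) ⟨p, mem_idealOfCofinals p 𝒟, hq⟩)).1 rfl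

end BackAndForth

theorem IsDiagram.exists_orderIso_apply_eq {Ω : Type*} [LinearOrder Ω] [Countable Ω]
    [DenselyOrdered Ω] [NoMinOrder Ω] [NoMaxOrder Ω] {D : Set (LGroupTerm × Ω × Ω)}
    (hD : IsDiagram D) (hfin : D.Finite) (t : LGroupTerm) :
    ∃ F : Ω ≃o Ω, ∀ {i j}, (t, i, j) ∈ D → F i = j := by
  rcases isEmpty_or_nonempty Ω with hΩ | hΩ
  · exact ⟨.refl Ω, fun {i} => hΩ.elim i⟩
  have hfin_t : {p | (t, p) ∈ D}.Finite := hfin.preimage (Prod.mk_right_injective t).injOn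
  obtain ⟨F, hF⟩ := exists_orderIso_extending (α := Ω) (β := Ω) ⟨hfin_t.toFinset, by
    rintro ⟨i, j⟩ hij ⟨i', j'⟩ hij'
    rw [Set.Finite.mem_toFinset] at hij hij'
    simp only [cmp, cmpUsing, hD.lt_iff_lt hij hij', hD.lt_iff_lt hij' hij]⟩
  exact ⟨F, fun h => hF _ (hfin_t.mem_toFinset.2 h)⟩

theorem Refutes.not_validInLGroups {Ω : Type u} [LinearOrder Ω] [Countable Ω]
    [DenselyOrdered Ω] [NoMinOrder Ω] [NoMaxOrder Ω] {D : Set (LGroupTerm × Ω × Ω)}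
    {s t : LGroupTerm} (h : Refutes D s t) (hfin : D.Finite) : ¬ ValidInLGroups.{u} s t := by
  intro hst
  choose v hv using fun n => h.isDiagram.exists_orderIso_apply_eq hfin (.var n)
  obtain ⟨i, j, k, hs, ht, hjk⟩ := h.exists_ne
  have eval_smul_eq {r i j} (he : (r, i, j) ∈ D) : r.eval v • i = j :=
    h.isDiagram.eval_smul_eq (fun {n} _ _ => hv n) he
  exact hjk (by rw [← eval_smul_eq hs, ← eval_smul_eq ht, hst])

/-- An entry of a diagram on the chain `ℕ`. -/
abbrev NatEntry : Type := LGroupTerm × ℕ × ℕ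

theorem Refutes.not_validInLGroups_of_nat {D : Set NatEntry} {s t : LGroupTerm}
    (h : Refutes D s t) (hfin : D.Finite) : ¬ ValidInLGroups.{u} s t := by
  let e : ℚ ≃o ULift.{u} ℚ := ULift.orderIso.symm
  have : DenselyOrdered (ULift.{u} ℚ) := (denselyOrdered_iff_of_orderIsoClass e).1 inferInstance
  have : NoMinOrder (ULift.{u} ℚ) := ⟨fun x => (exists_lt x.down).imp' e fun _ => id⟩
  have : NoMaxOrder (ULift.{u} ℚ) := ⟨fun x => (exists_gt x.down).imp' e fun _ => id⟩
  have hmono : StrictMono fun n : ℕ => e n := e.strictMono.comp Nat.strictMono_cast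
  exact (h.image hmono.monotone (hmono.strictMonoOn Set.univ) fun _ => ⟨trivial, trivial⟩)
    |>.not_validInLGroups (hfin.image _)

/-- A strict bound for the points and the codes of terms in some diagram refuting `s ≈ t`. -/
def refutationBound (s t : LGroupTerm) : ℕ := 2 * (s.toCode + t.toCode + 2)

theorem exists_refutes_of_not_validInLGroups {s t : LGroupTerm}
    (h : ¬ ValidInLGroups.{u} s t) : ∃ D : Set NatEntry, Refutes D s t ∧
      ∀ {r : LGroupTerm} {i j}, (r, i, j) ∈ D → r.toCode < refutationBound s t ∧
        i < refutationBound s t ∧ j < refutationBound s t := by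
  simp only [ValidInLGroups, not_forall] at h
  obtain ⟨L, _, _, _, _, v, hne⟩ := h
  obtain ⟨Ω, _, _, _, x, hx⟩ := exists_isChainAction_smul_ne hne
  let l : List (LGroupTerm × Ω × Ω) := trace v s x ++ trace v t x
  let S : Finset Ω := (l.flatMap fun e => [e.2.1, e.2.2]).toFinset
  have mem_S {r i j} (he : (r, i, j) ∈ l) : i ∈ S ∧ j ∈ S := by
    constructor <;> exact List.mem_toFinset.2 (List.mem_flatMap.2 ⟨_, he, by simp⟩)
  have card_S_le : S.card ≤ refutationBound s t := by
    refine (List.toFinset_card_le _).trans ?_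
    have hs := length_trace_le v s x
    have ht := length_trace_le v t x
    simp only [l, List.length_flatMap, List.length_cons, List.length_nil, List.map_const',
      List.sum_replicate, List.length_append, smul_eq_mul, refutationBound]
    omega
  obtain ⟨f, hf, hfS, hlt⟩ := exists_monotone_strictMonoOn_lt_card S
  refine ⟨_, (refutes_trace_append_trace hx).image hf hfS mem_S, ?_⟩
  rintro - - - ⟨⟨r, i, j⟩, he, ⟨⟩⟩
  refine ⟨?_, (hlt i (mem_S he).1).trans_le card_S_le, (hlt j (mem_S he).2).trans_le card_S_le⟩
  obtain hr | hr : r.toCode ≤ s.toCode ∨ r.toCode ≤ t.toCode :=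
    (List.mem_append.1 he).imp toCode_le_of_mem_trace toCode_le_of_mem_trace
  all_goals
    change r.toCode < 2 * (s.toCode + t.toCode + 2)
    omega

/-- All entries within the bounds of `refutationBound`, and possibly further ones. -/
def candidateEntries (s t : LGroupTerm) : List NatEntry :=
  let B := refutationBound s t
  (List.range (Nat.pair B (Nat.pair B B))).map (Denumerable.ofNat _)

theorem mem_candidateEntries {s t r : LGroupTerm} {i j : ℕ} (hr : r.toCode < refutationBound s t)
    (hi : i < refutationBound s t) (hj : j < refutationBound s t) :
    (r, i, j) ∈ candidateEntries s t := by
  refine List.mem_map.2 ⟨Nat.pair r.toCode (Nat.pair i j), List.mem_range.2 ?_,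
    Denumerable.ofNat_encode (r, i, j)⟩
  exact (Nat.pair_lt_pair_left _ hr).trans
    (Nat.pair_lt_pair_right _ ((Nat.pair_lt_pair_left _ hi).trans (Nat.pair_lt_pair_right _ hj)))

theorem validInLGroups_iff {s t : LGroupTerm} : ValidInLGroups.{u} s t ↔
    ¬ ∃ l ∈ (candidateEntries s t).sublists', Refutes {e | e ∈ l} s t := by
  classical
  constructor
  · rintro hst ⟨l, -, h⟩
    exact h.not_validInLGroups_of_nat l.finite_toSet hst
  · contrapose!
    intro h
    obtain ⟨D, hD, hlt⟩ := exists_refutes_of_not_validInLGroups h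
    have D_eq : {e | e ∈ (candidateEntries s t).filter (· ∈ D)} = D := by
      ext ⟨r, i, j⟩
      simp only [List.mem_filter, Set.mem_ofPred_eq, decide_eq_true_eq, and_iff_right_iff_imp]
      exact fun he => mem_candidateEntries (hlt he).1 (hlt he).2.1 (hlt he).2.2
    exact ⟨_, List.mem_sublists'.2 List.filter_sublist, D_eq.symm ▸ hD⟩

section Primrec

variable {α β : Type*} [Primcodable α] [Primcodable β]

theorem primrecPred_exists_mem {l : α → List β} {p : α × β → Prop} (hl : Primrec l)
    (hp : PrimrecPred p) : PrimrecPred fun a => ∃ b ∈ l a, p (a, b) :=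
  (PrimrecRel.exists_mem_list (R := fun b a => p (a, b)) (hp.comp (Primrec.pair .snd .fst))).comp
    hl .id

theorem primrecPred_forall_mem {l : α → List β} {p : α × β → Prop} (hl : Primrec l)
    (hp : PrimrecPred p) : PrimrecPred fun a => ∀ b ∈ l a, p (a, b) :=
  (PrimrecRel.forall_mem_list (R := fun b a => p (a, b)) (hp.comp (Primrec.pair .snd .fst))).comp
    hl .id

theorem primrecPred_imp {p q : α → Prop} (hp : PrimrecPred p) (hq : PrimrecPred q) :
    PrimrecPred fun a => p a → q a :=
  (hp.not.or hq).of_eq fun _ => imp_iff_not_or.symm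

theorem primrecPred_iff {p q : α → Prop} (hp : PrimrecPred p) (hq : PrimrecPred q) :
    PrimrecPred fun a => (p a ↔ q a) :=
  ((primrecPred_imp hp hq).and (primrecPred_imp hq hp)).of_eq fun _ => iff_def.symm

theorem primrec_sublists' : Primrec (List.sublists' : List α → List (List α)) := by
  have sublists'_eq_foldr (l : List α) :
      l.foldr (fun a L => L ++ L.map (a :: ·)) [[]] = l.sublists' := by
    induction l with
    | nil => rfl
    | cons a l ih => rw [List.foldr_cons, ih, List.sublists'_cons]
  have hmap : Primrec₂ fun (_ : List α) (x : α × List (List α)) => x.2 ++ x.2.map (x.1 :: ·) :=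
    Primrec.list_append.comp (Primrec.snd.comp .snd) <|
      Primrec.list_map (Primrec.snd.comp .snd) <|
        Primrec.list_cons.comp (Primrec.fst.comp (Primrec.snd.comp .fst)) .snd
  exact (Primrec.list_foldr .id (.const [[]]) hmap).of_eq sublists'_eq_foldr

end Primrec

namespace LGroupTerm

theorem primrec_toCode : Primrec toCode := Primrec.encode

theorem primrecPred_isVar : PrimrecPred fun t : LGroupTerm => ∃ n, t = var n := by
  refine (Primrec.eq.comp (Primrec.nat_mod.comp primrec_toCode (.const 5)) (.const 1)).of_eq
    fun t => ?_
  cases t <;> simp [toCode] <;> omega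

theorem primrec_inv : Primrec inv :=
  Primrec.encode_iff.1 <| Primrec.succ.comp <| Primrec.succ.comp <|
    Primrec.nat_mul.comp (.const 5) primrec_toCode

theorem primrec_code_binary (r : ℕ) : Primrec₂ fun s t => 5 * Nat.pair (toCode s) (toCode t) + r :=
  Primrec.nat_add.comp (Primrec.nat_mul.comp (.const 5)
    (Primrec₂.natPair.comp (primrec_toCode.comp .fst) (primrec_toCode.comp .snd))) (.const r)

theorem primrec_mul : Primrec₂ mul := Primrec.encode_iff.1 (primrec_code_binary 3)

theorem primrec_inf : Primrec₂ inf := Primrec.encode_iff.1 (primrec_code_binary 4)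

theorem primrec_sup : Primrec₂ sup := Primrec.encode_iff.1 (primrec_code_binary 5)

end LGroupTerm

theorem isJustified_iff {α : Type*} [LinearOrder α] {D : Set (LGroupTerm × α × α)}
    {t : LGroupTerm} {i j : α} : IsJustified D t i j ↔
      (∃ n, t = .var n) ∨ (t = .one ∧ i = j) ∨ (∃ e ∈ D, t = .inv e.1 ∧ e.2 = (j, i)) ∨
      (∃ e ∈ D, ∃ e' ∈ D, t = .mul e'.1 e.1 ∧ e.2.1 = i ∧ e'.2 = (e.2.2, j)) ∨
      (∃ e ∈ D, ∃ e' ∈ D, (e.2.1 = i ∧ e'.2.1 = i) ∧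
        (t = .inf e.1 e'.1 ∧ j = min e.2.2 e'.2.2 ∨ t = .sup e.1 e'.1 ∧ j = max e.2.2 e'.2.2)) := by
  constructor
  · rintro (⟨n⟩ | _ | ht | ⟨ht, hs⟩ | ⟨hs, ht⟩ | ⟨hs, ht⟩)
    · exact .inl ⟨n, rfl⟩
    · exact .inr (.inl ⟨rfl, rfl⟩)
    · exact .inr (.inr (.inl ⟨_, ht, rfl, rfl⟩))
    · exact .inr (.inr (.inr (.inl ⟨_, ht, _, hs, rfl, rfl, rfl⟩)))
    · exact .inr (.inr (.inr (.inr ⟨_, hs, _, ht, ⟨rfl, rfl⟩, .inl ⟨rfl, rfl⟩⟩)))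
    · exact .inr (.inr (.inr (.inr ⟨_, hs, _, ht, ⟨rfl, rfl⟩, .inr ⟨rfl, rfl⟩⟩)))
  · rintro (⟨n, rfl⟩ | ⟨rfl, rfl⟩ | ⟨⟨r, _⟩, hr, rfl, rfl⟩ |
      ⟨⟨r, _, k⟩, hr, ⟨r', _⟩, hr', rfl, rfl, rfl⟩ |
      ⟨⟨r, k, _⟩, hr, ⟨r', _, _⟩, hr', ⟨rfl, rfl⟩, ⟨rfl, rfl⟩ | ⟨rfl, rfl⟩⟩)
    exacts [.var .., .one _, .inv hr, .mul hr hr', .inf hr hr', .sup hr hr']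

theorem NatEntry.primrec_term : Primrec fun e : NatEntry => e.1 := .fst

theorem NatEntry.primrec_source : Primrec fun e : NatEntry => e.2.1 := Primrec.fst.comp .snd

theorem NatEntry.primrec_target : Primrec fun e : NatEntry => e.2.2 := Primrec.snd.comp .snd

open NatEntry in
theorem primrecPred_isJustified : PrimrecPred fun x : List NatEntry × NatEntry =>
    IsJustified {e | e ∈ x.1} x.2.1 x.2.2.1 x.2.2.2 := by
  have one : PrimrecPred fun x : List NatEntry × NatEntry =>
      x.2.1 = .one ∧ x.2.2.1 = x.2.2.2 :=
    (Primrec.eq.comp (primrec_term.comp .snd) (.const _)).and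
      (Primrec.eq.comp (primrec_source.comp .snd) (primrec_target.comp .snd))
  have inv : PrimrecPred fun x : (List NatEntry × NatEntry) × NatEntry =>
      x.1.2.1 = .inv x.2.1 ∧ x.2.2 = (x.1.2.2.2, x.1.2.2.1) :=
    have entry := Primrec.snd.comp .fst
    (Primrec.eq.comp (primrec_term.comp entry)
      (LGroupTerm.primrec_inv.comp (primrec_term.comp .snd))).and <|
      Primrec.eq.comp (Primrec.snd.comp .snd)
        ((primrec_target.comp entry).pair (primrec_source.comp entry))
  have entry : Primrec fun x : ((List NatEntry × NatEntry) × NatEntry) × NatEntry => x.1.1.2 :=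
    Primrec.snd.comp (Primrec.fst.comp .fst)
  have arg₁ : Primrec fun x : ((List NatEntry × NatEntry) × NatEntry) × NatEntry => x.1.2 :=
    Primrec.snd.comp .fst
  have arg₂ : Primrec fun x : ((List NatEntry × NatEntry) × NatEntry) × NatEntry => x.2 := .snd
  have mul := (Primrec.eq.comp (primrec_term.comp entry)
      (LGroupTerm.primrec_mul.comp (primrec_term.comp arg₂) (primrec_term.comp arg₁))).and <|
    (Primrec.eq.comp (primrec_source.comp arg₁) (primrec_source.comp entry)).and <|
      Primrec.eq.comp (Primrec.snd.comp arg₂)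
        ((primrec_target.comp arg₁).pair (primrec_target.comp entry))
  have source_eq := (Primrec.eq.comp (primrec_source.comp arg₁) (primrec_source.comp entry)).and
    (Primrec.eq.comp (primrec_source.comp arg₂) (primrec_source.comp entry))
  have inf := (Primrec.eq.comp (primrec_term.comp entry)
      (LGroupTerm.primrec_inf.comp (primrec_term.comp arg₁) (primrec_term.comp arg₂))).and <|
    Primrec.eq.comp (primrec_target.comp entry)
      (Primrec.nat_min.comp (primrec_target.comp arg₁) (primrec_target.comp arg₂))
  have sup := (Primrec.eq.comp (primrec_term.comp entry)
      (LGroupTerm.primrec_sup.comp (primrec_term.comp arg₁) (primrec_term.comp arg₂))).and <|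
    Primrec.eq.comp (primrec_target.comp entry)
      (Primrec.nat_max.comp (primrec_target.comp arg₁) (primrec_target.comp arg₂))
  exact ((LGroupTerm.primrecPred_isVar.comp (primrec_term.comp .snd)).or <| one.or <|
    (primrecPred_exists_mem .fst inv).or <|
    (primrecPred_exists_mem .fst (primrecPred_exists_mem (Primrec.fst.comp .fst) mul)).or
      (primrecPred_exists_mem .fst (primrecPred_exists_mem (Primrec.fst.comp .fst)
        (source_eq.and (inf.or sup))))).of_eq fun _ => isJustified_iff.symm

theorem isDiagram_iff {α : Type*} [LinearOrder α] {D : Set (LGroupTerm × α × α)} :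
    IsDiagram D ↔ (∀ e ∈ D, ∀ e' ∈ D, e.1 = e'.1 → (e.2.1 < e'.2.1 ↔ e.2.2 < e'.2.2)) ∧
      ∀ e ∈ D, IsJustified D e.1 e.2.1 e.2.2 := by
  refine ⟨fun h => ⟨?_, fun e he => h.isJustified he⟩,
    fun h => ⟨fun hij hij' => h.1 _ hij _ hij' rfl, fun he => h.2 _ he⟩⟩
  rintro ⟨t, i, j⟩ hij ⟨-, i', j'⟩ hij' rfl
  exact h.lt_iff_lt hij hij'

open NatEntry in
theorem primrecPred_isDiagram : PrimrecPred fun l : List NatEntry => IsDiagram {e | e ∈ l} := by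
  have e : Primrec fun x : (List NatEntry × NatEntry) × NatEntry => x.1.2 := Primrec.snd.comp .fst
  have e' : Primrec fun x : (List NatEntry × NatEntry) × NatEntry => x.2 := .snd
  have term_eq := Primrec.eq.comp (primrec_term.comp e) (primrec_term.comp e')
  have lt_iff_lt := primrecPred_iff
    (Primrec.nat_lt.comp (primrec_source.comp e) (primrec_source.comp e'))
    (Primrec.nat_lt.comp (primrec_target.comp e) (primrec_target.comp e'))
  exact ((primrecPred_forall_mem .id <| primrecPred_forall_mem .fst <|
    primrecPred_imp term_eq lt_iff_lt).and
      (primrecPred_forall_mem .id primrecPred_isJustified)).of_eq fun _ => isDiagram_iff.symm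

theorem refutes_iff {α : Type*} [LinearOrder α] {D : Set (LGroupTerm × α × α)}
    {s t : LGroupTerm} : Refutes D s t ↔ IsDiagram D ∧ ∃ e ∈ D, ∃ e' ∈ D,
      (e.1 = s ∧ e'.1 = t) ∧ e.2.1 = e'.2.1 ∧ e.2.2 ≠ e'.2.2 := by
  constructor
  · rintro ⟨hD, i, j, k, hs, ht, hjk⟩
    exact ⟨hD, _, hs, _, ht, ⟨rfl, rfl⟩, rfl, hjk⟩
  · rintro ⟨hD, ⟨_, i, j⟩, hs, ⟨_, _, k⟩, ht, ⟨rfl, rfl⟩, rfl, hjk⟩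
    exact ⟨hD, i, j, k, hs, ht, hjk⟩

open NatEntry in
theorem primrecPred_refutes : PrimrecPred fun x : List NatEntry × LGroupTerm × LGroupTerm =>
    Refutes {e | e ∈ x.1} x.2.1 x.2.2 := by
  have eqn : Primrec fun x : ((List NatEntry × LGroupTerm × LGroupTerm) × NatEntry) × NatEntry =>
      x.1.1.2 := Primrec.snd.comp (Primrec.fst.comp .fst)
  have e : Primrec fun x : ((List NatEntry × LGroupTerm × LGroupTerm) × NatEntry) × NatEntry =>
      x.1.2 := Primrec.snd.comp .fst
  have e' : Primrec fun x : ((List NatEntry × LGroupTerm × LGroupTerm) × NatEntry) × NatEntry =>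
      x.2 := .snd
  have terms := (Primrec.eq.comp (primrec_term.comp e) (Primrec.fst.comp eqn)).and
    (Primrec.eq.comp (primrec_term.comp e') (Primrec.snd.comp eqn))
  have points := (Primrec.eq.comp (primrec_source.comp e) (primrec_source.comp e')).and
    (Primrec.eq.comp (primrec_target.comp e) (primrec_target.comp e')).not
  exact ((primrecPred_isDiagram.comp .fst).and <| primrecPred_exists_mem .fst <|
    primrecPred_exists_mem (Primrec.fst.comp .fst) (terms.and points)).of_eq
      fun x => (refutes_iff (s := x.2.1) (t := x.2.2)).symm

theorem primrec_refutationBound : Primrec₂ refutationBound :=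
  Primrec.nat_mul.comp (.const 2) <| Primrec.nat_add.comp (Primrec.nat_add.comp
    (LGroupTerm.primrec_toCode.comp .fst) (LGroupTerm.primrec_toCode.comp .snd)) (.const 2)

theorem primrec_candidateEntries : Primrec₂ candidateEntries :=
  Primrec.list_map
    (Primrec.list_range.comp <| Primrec₂.natPair.comp primrec_refutationBound <|
      Primrec₂.natPair.comp primrec_refutationBound primrec_refutationBound)
    ((Primrec.ofNat _).comp .snd)

theorem corollaryc_general :
    PrimrecPred fun eqn : LGroupTerm × LGroupTerm => ValidInLGroups.{u} eqn.1 eqn.2 := by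
  have refutes : PrimrecPred fun x : (LGroupTerm × LGroupTerm) × List NatEntry =>
      Refutes {e | e ∈ x.2} x.1.1 x.1.2 := primrecPred_refutes.comp (Primrec.pair .snd .fst)
  exact (primrecPred_exists_mem (primrec_sublists'.comp primrec_candidateEntries) refutes).not.of_eq
    fun _ => validInLGroups_iff.symm

theorem corollaryc :
    ComputablePred fun eqn : LGroupTerm × LGroupTerm => ValidInLGroups.{u} eqn.1 eqn.2 := by
  exact corollaryc_general.computablePred
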